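/- Let $h\ge 1$, $t\ge 2$ be integers such that $s=ht+1$ is a prime power, let $F$ be the field of order $s$ and $F^*=F\setminus\{0\}$. Let $C_0$ be the subgroup of $F^*$ of order $t$, and index its cosets as $C_i$, $i\in I_h=\mathbb Z/h$, so that $C_iC_j=C_{i+j}$. Choose $p_i\in C_i$ for each $i\in I_h$. Consider the following setting: the units are the pairs $(a,b)\in F^*\times F$, there are $h$ block factors indexed by $I_h$, each with level set $F$, and the $i$th block factor has level $ap_i+b$ on the unit $(a,b)$. A design in this setting is a surjective map $d$ from the units to the set $V=F\times I_h$ of treatments; put $v=|V|=hs$. For a design $d$ let $X_V$ be the unit-by-treatment $0,1$ matrix of $d$, let $X_i$ be the unit-by-level $0,1$ matrix of the $i$th block factor, let $N_i=X_V'X_i$ and $H=\sum_{i\in I_h}N_i$, and let $C_d=X_V'(I-P)X_V$, where $P$ is the orthogonal projection onto the span of the all-ones vector and the columns of all the $X_i$. The design $d$ is connected if $\operatorname{rank} C_d=v-1$, equireplicate if every treatment occurs on the same number of units, and totally binary if all entries of $H$ are $0$ or $1$. Let $\mu_0(C_d)\le\dots\le\mu_{v-1}(C_d)$ be the eigenvalues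 of $C_d$, with multiplicity. Let $d_1^*$ be the design that assigns to the unit $(a,b)$ the treatment $(b,i)$, where $a\in C_i$. Then: 1. the setting is of type 1: there are $s(s-1)$ units, each block factor has $s$ levels, and $X_i'X_j=J_s-I_s$ for all $i\ne j$, where $J_s$ is the all-ones matrix; 2. $d_1^*$ is connected, equireplicate and totally binary; 3. $d_1^*$ is M-optimal in the class of all equireplicate and totally binary designs in this setting: for every such design $d$, $$\sum_{i=0}^{k}\mu_i(C_{d_1^*})\ \ge\ \sum_{i=0}^{k}\mu_i(C_d),\qquad k=0,1,\dots,v-1 .$$ -/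

import Mathlib

namespace MultiwayDesign

section General

variable {U B L V : Type*}

/-- A multi-way experimental set up: the units `U`, the block factors `B`, and the level of each
block factor on each unit. All block factors share the level set `L`, and every level of every
block factor occurs. -/
structure Setting (U B L : Type*) where
  level : U → B → L
  level_surjective : ∀ A : B, Function.Surjective fun u => level u A

/-- A design in the set up `σ` with treatment set `V`: an allocation of treatments to the units in
which every treatment occurs. -/
structure Design (σ : Setting U B L) (V : Type*) where
  treatment : U → V
  treatment_surjective : Function.Surjective treatment

/-- The design matrix of a factor: the `(u, p)` entry is `1` if the factor is at level `p` on the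
unit `u`, and `0` otherwise. -/
def designMatrix {S : Type*} [DecidableEq S] (f : U → S) : Matrix U S ℝ :=
  Matrix.of fun u p => if f u = p then 1 else 0

/-- The matrix of the orthogonal projection onto the column space of `M`. -/
noncomputable def colProj {m n : Type*} [Fintype m] [DecidableEq m] [Fintype n] [DecidableEq n]
    (M : Matrix m n ℝ) : Matrix m m ℝ :=
  Matrix.toEuclideanLin.symm
    ((LinearMap.range (Matrix.toEuclideanLin M)).starProjection :
      EuclideanSpace ℝ m →ₗ[ℝ] EuclideanSpace ℝ m)

theorem colProj_isHermitian {m n : Type*} [Fintype m] [DecidableEq m] [Fintype n] [DecidableEq n]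
    (M : Matrix m n ℝ) : (colProj M).IsHermitian := by
  rw [← Matrix.isSymmetric_toEuclideanLin_iff, colProj, LinearEquiv.apply_symm_apply]
  exact Submodule.starProjection_isSymmetric _

namespace Setting

/-- The design matrix `X_A` of the block factor `A`. -/
def blockMatrix [DecidableEq L] (σ : Setting U B L) (A : B) : Matrix U L ℝ :=
  designMatrix fun u => σ.level u A

/-- The incidence matrix `M_{AA'} = X_A' X_{A'}` of two block factors. -/
def incidence [Fintype U] [DecidableEq L] (σ : Setting U B L) (A A' : B) : Matrix L L ℝ :=
  (σ.blockMatrix A).transpose * σ.blockMatrix A'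

/-- The design matrix of all factors other than the treatment factor: the column of ones of the
general effect, followed by the columns of the matrices `X_A` of all block factors `A`. -/
def nuisanceMatrix [DecidableEq L] (σ : Setting U B L) : Matrix U (Unit ⊕ B × L) ℝ :=
  Matrix.fromCols (Matrix.of fun _ _ => 1) (Matrix.of fun u Al => σ.blockMatrix Al.1 u Al.2)

/-- A setting of type 1: with `s` the number of levels of each block factor, there are `s(s-1)`
units and `M_{AA'} = J_s - I_s` for any two distinct block factors. -/
def IsTypeOne [Fintype U] [Fintype L] [DecidableEq L] (σ : Setting U B L) : Prop :=
  Fintype.card U = Fintype.card L * (Fintype.card L - 1) ∧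
    ∀ A A' : B, A ≠ A' → σ.incidence A A' = (Matrix.of fun _ _ => 1) - 1

end Setting

/-- The eigenvalues of a real symmetric matrix, with multiplicity, in nondecreasing order. -/
noncomputable def ascEigenvalues {n : Type*} [Fintype n] [DecidableEq n] {A : Matrix n n ℝ}
    (hA : A.IsHermitian) : Fin (Fintype.card n) → ℝ :=
  fun i => hA.eigenvalues₀ i.rev

/-- For nondecreasing vectors, `x` is weakly majorized from above by `y`: every partial sum of the
smallest entries of `x` is at least the corresponding partial sum for `y`. -/
def WeaklyMajorizedFromAbove {n : ℕ} (x y : Fin n → ℝ) : Prop :=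
  ∀ k : Fin n, ∑ i ∈ Finset.Iic k, y i ≤ ∑ i ∈ Finset.Iic k, x i

namespace Design

variable {σ : Setting U B L}

/-- The design matrix `X_V` of the treatment factor. -/
def treatmentMatrix [DecidableEq V] (d : Design σ V) : Matrix U V ℝ :=
  designMatrix d.treatment

/-- The treatment versus `A` incidence matrix `N_A = X_V' X_A`. -/
def incidence [Fintype U] [DecidableEq L] [DecidableEq V] (d : Design σ V) (A : B) :
    Matrix V L ℝ :=
  d.treatmentMatrix.transpose * σ.blockMatrix A

/-- `H = ∑_A N_A`, the sum being over all block factors. -/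
def totalIncidence [Fintype U] [Fintype B] [DecidableEq L] [DecidableEq V] (d : Design σ V) :
    Matrix V L ℝ :=
  ∑ A : B, d.incidence A

/-- Every treatment occurs on the same number of units. -/
def Equireplicate [Fintype U] [DecidableEq V] (d : Design σ V) : Prop :=
  ∃ r : ℕ, ∀ p : V, (Finset.univ.filter fun u => d.treatment u = p).card = r

/-- All entries of `H` are `0` or `1`. -/
def TotallyBinary [Fintype U] [Fintype B] [DecidableEq L] [DecidableEq V] (d : Design σ V) :
    Prop :=
  ∀ p l, d.totalIncidence p l = 0 ∨ d.totalIncidence p l = 1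

section CMatrix

variable [Fintype U] [DecidableEq U] [Fintype B] [DecidableEq B] [Fintype L] [DecidableEq L]
  [DecidableEq V]

/-- The C-matrix `X_V' (I - P) X_V`, where `P` is the projection onto the column space of the
design matrix of all factors other than the treatment factor. -/
noncomputable def cMatrix (d : Design σ V) : Matrix V V ℝ :=
  d.treatmentMatrix.transpose * (1 - colProj σ.nuisanceMatrix) * d.treatmentMatrix

theorem cMatrix_isHermitian (d : Design σ V) : d.cMatrix.IsHermitian := by
  have h := Matrix.isHermitian_conjTranspose_mul_mul d.treatmentMatrix
    (Matrix.isHermitian_one.sub (colProj_isHermitian σ.nuisanceMatrix))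
  rwa [Matrix.conjTranspose_eq_transpose_of_trivial] at h

/-- The design is connected: its C-matrix has rank `v - 1`. -/
def Connected [Fintype V] (d : Design σ V) : Prop :=
  d.cMatrix.rank + 1 = Fintype.card V

/-- `d` is M-better than `d'`: the eigenvalue vector of `C_d` is weakly majorized from above by
that of `C_{d'}`. -/
def MBetter [Fintype V] (d d' : Design σ V) : Prop :=
  WeaklyMajorizedFromAbove (ascEigenvalues d.cMatrix_isHermitian)
    (ascEigenvalues d'.cMatrix_isHermitian)

/-- `d` is M-optimal in the class `D`: it belongs to `D` and is M-better than every member. -/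
def MOptimal [Fintype V] (D : Set (Design σ V)) (d : Design σ V) : Prop :=
  d ∈ D ∧ ∀ d' ∈ D, d.MBetter d'

end CMatrix

/-- The class of all equireplicate and totally binary designs in a set up. -/
def equireplicateTotallyBinary [Fintype U] [Fintype B] [DecidableEq L] [DecidableEq V]
    (σ : Setting U B L) : Set (Design σ V) :=
  {d | d.Equireplicate ∧ d.TotallyBinary}

end Design

end General

section DOne

variable {F : Type*} [Field F] {h : ℕ}

/-- The set up of `d₁*`: the units are the pairs `(a, b)` with `a ∈ F*` and `b ∈ F`, the block
factors are indexed by the integers modulo `h`, and factor `i` has level `a p_i + b` on the unit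
`(a, b)`. -/
def settingOne (p : ZMod h → Fˣ) : Setting (Fˣ × F) (ZMod h) F where
  level u i := (u.1 : F) * (p i : F) + u.2
  level_surjective i x := ⟨(1, x - p i), by simp⟩

/-- The design `d₁*`, with treatment set `F × ℤ/h`: the unit `(a, b)` receives the treatment
`(b, i)` with `a ∈ C_i`. The indexing `i ↦ C_i` of the cosets of `C₀` in `F*`, with
`C_i C_j = C_{i+j}`, is the isomorphism `C`. -/
def dOne {C₀ : Subgroup Fˣ} (C : Multiplicative (ZMod h) ≃* Fˣ ⧸ C₀) (p : ZMod h → Fˣ) :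
    Design (settingOne p) (F × ZMod h) where
  treatment u := (u.2, (C.symm (u.1 : Fˣ ⧸ C₀)).toAdd)
  treatment_surjective := by
    rintro ⟨x, i⟩
    obtain ⟨a, ha⟩ := QuotientGroup.mk_surjective (C (Multiplicative.ofAdd i))
    exact ⟨(a, x), by simp [ha]⟩

end DOne

end MultiwayDesign

/-! The space spanned by the block factors is the orthogonal sum of the images of three strata of
`ℝ ^ (F × ℤ/h)`, on each of which the Gram matrix of the block factors is a scalar. So, with `t` the
replication, `C_d = t • 1 - (D₀ + D₁ + D₂)`, where `D_i` is the information lost to stratum `i`.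
The rank of `D_i` is at most the dimension of the stratum, and for equireplicate, totally binary
designs its trace does not depend on the design. For `d₁*` each `D_i` is a scalar multiple `r_i E_i`
of the projection `E_i` onto a stratum of the treatments of the same dimension, which spreads the
lost information over as many eigenvalues as the rank allows.

For a competitor let `μ` be its `k`-th eigenvalue. Testing its C-matrix on the range of the sum of
those `D_i` with `r_i > t - μ` bounds its `k`-th partial sum from above by the quantity
`(k + 1) μ - ∑ max (r_i - (t - μ)) 0 * tr E_i`, which bounds the one of `d₁*` from below. -/

namespace MultiwayDesign

open Matrix
open scoped MatrixOrder Kronecker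

section EigenvalueSums

variable {n : Type*} [Fintype n] [DecidableEq n] {A : Matrix n n ℝ}

/-- The diagonal entries of a matrix in an orthonormal eigenbasis of `A`, listed by increasing
eigenvalue. -/
noncomputable def eigenDiag (hA : A.IsHermitian) :
    Matrix n n ℝ →ₗ[ℝ] (Fin (Fintype.card n) → ℝ) where
  toFun T i := Unitary.conjStarAlgAut ℝ _ (star hA.eigenvectorUnitary) T
    (Fintype.equivOfCardEq (Fintype.card_fin _) i.rev)
    (Fintype.equivOfCardEq (Fintype.card_fin _) i.rev)
  map_add' S T := by
    ext i
    simp only [map_add, Matrix.add_apply, Pi.add_apply]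
  map_smul' c T := by
    ext i
    simp only [map_smul, Matrix.smul_apply, Pi.smul_apply, RingHom.id_apply]

theorem ascEigenvalues_monotone (hA : A.IsHermitian) : Monotone (ascEigenvalues hA) :=
  fun _ _ hij => hA.eigenvalues₀_antitone (Fin.rev_le_rev.2 hij)

theorem eigenDiag_one (hA : A.IsHermitian) : eigenDiag hA 1 = 1 := by
  ext i
  simp [eigenDiag]

theorem eigenDiag_mul_self (hA : A.IsHermitian) (T : Matrix n n ℝ) :
    eigenDiag hA (T * A) = eigenDiag hA T * ascEigenvalues hA := by
  ext i
  simp only [eigenDiag, LinearMap.coe_mk, AddHom.coe_mk, map_mul,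
    hA.conjStarAlgAut_star_eigenvectorUnitary, mul_diagonal, Pi.mul_apply]
  simp [ascEigenvalues, IsHermitian.eigenvalues]

theorem eigenDiag_self (hA : A.IsHermitian) : eigenDiag hA A = ascEigenvalues hA := by
  simpa [eigenDiag_one] using eigenDiag_mul_self hA 1

theorem sum_eigenDiag (hA : A.IsHermitian) (T : Matrix n n ℝ) :
    ∑ i, eigenDiag hA T i = T.trace := by
  calc ∑ i, eigenDiag hA T i
      = (Unitary.conjStarAlgAut ℝ _ (star hA.eigenvectorUnitary) T).trace :=
        Equiv.sum_comp (Fin.revPerm.trans (Fintype.equivOfCardEq (Fintype.card_fin _)))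
          (Unitary.conjStarAlgAut ℝ _ (star hA.eigenvectorUnitary) T).diag
    _ = T.trace := by
        rw [Unitary.conjStarAlgAut_star_apply, trace_mul_comm, ← Matrix.mul_assoc,
          Unitary.mul_star_self_of_mem hA.eigenvectorUnitary.2, Matrix.one_mul]

theorem eigenDiag_nonneg (hA : A.IsHermitian) {T : Matrix n n ℝ} (hT : 0 ≤ T) :
    0 ≤ eigenDiag hA T := fun i => by
  simpa [eigenDiag] using! (star_left_conjugate_nonneg hT _).posSemidef.diag_nonneg

theorem eigenDiag_mono (hA : A.IsHermitian) : Monotone (eigenDiag hA) := fun S T hST => by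
  simpa [map_sub] using eigenDiag_nonneg hA (sub_nonneg.2 hST)

theorem ascEigenvalues_le_of_le_smul_one (hA : A.IsHermitian) {c : ℝ} (hc : A ≤ c • 1)
    (i : Fin (Fintype.card n)) : ascEigenvalues hA i ≤ c := by
  simpa [eigenDiag_self, eigenDiag_one] using eigenDiag_mono hA hc i

theorem sum_Iic_ascEigenvalues_le (hA : A.IsHermitian) {T : Matrix n n ℝ} (h0 : 0 ≤ T)
    (h1 : T ≤ 1) (k : Fin (Fintype.card n)) :
    ∑ i ∈ Finset.Iic k, ascEigenvalues hA i ≤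
      (k + 1) * ascEigenvalues hA k + (T * (A - ascEigenvalues hA k • 1)).trace := by
  set μ := ascEigenvalues hA
  have hmono : Monotone μ := ascEigenvalues_monotone hA
  have hw0 (i) : 0 ≤ eigenDiag hA T i := eigenDiag_nonneg hA h0 i
  have hw1 (i) : eigenDiag hA T i ≤ 1 := by
    simpa [eigenDiag_one] using eigenDiag_mono hA h1 i
  have hle : ∑ i ∈ Finset.Iic k, (μ i - μ k) ≤ (T * (A - μ k • 1)).trace := calc
    ∑ i ∈ Finset.Iic k, (μ i - μ k)
      ≤ ∑ i ∈ Finset.Iic k, eigenDiag hA T i * (μ i - μ k) :=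
        Finset.sum_le_sum fun i hi => by
          nlinarith [hw1 i, hmono (Finset.mem_Iic.1 hi)]
    _ ≤ ∑ i, eigenDiag hA T i * (μ i - μ k) :=
        Finset.sum_le_sum_of_subset_of_nonneg (Finset.subset_univ _) fun i _ hi =>
          mul_nonneg (hw0 i) (sub_nonneg.2 (hmono (not_le.1 (Finset.mem_Iic.not.1 hi)).le))
    _ = (T * (A - μ k • 1)).trace := by
        rw [← sum_eigenDiag hA, Matrix.mul_sub, map_sub, eigenDiag_mul_self]
        simp [mul_sub, mul_comm (μ k), μ, Finset.sum_sub_distrib]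
  rw [Finset.sum_sub_distrib, Finset.sum_const, Fin.card_Iic, nsmul_eq_mul] at hle
  push_cast at hle
  linarith

theorem le_sum_Iic_ascEigenvalues (hA : A.IsHermitian) {c : ℝ} {W : Matrix n n ℝ} (hW : 0 ≤ W)
    (h : c • 1 ≤ A + W) (k : Fin (Fintype.card n)) :
    (k + 1) * c - W.trace ≤ ∑ i ∈ Finset.Iic k, ascEigenvalues hA i := by
  have hle : ∑ i ∈ Finset.Iic k, (c - eigenDiag hA W i) ≤
      ∑ i ∈ Finset.Iic k, ascEigenvalues hA i := Finset.sum_le_sum fun i _ => by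
    simpa [eigenDiag_self, eigenDiag_one] using eigenDiag_mono hA h i
  have htr : ∑ i ∈ Finset.Iic k, eigenDiag hA W i ≤ W.trace := by
    rw [← sum_eigenDiag hA]
    exact Finset.sum_le_sum_of_subset_of_nonneg (Finset.subset_univ _)
      fun i _ _ => eigenDiag_nonneg hA hW i
  rw [Finset.sum_sub_distrib, Finset.sum_const, Fin.card_Iic, nsmul_eq_mul] at hle
  push_cast at hle
  linarith

end EigenvalueSums

section Projections

theorem rank_add_le {m n : Type*} [Fintype n] [Finite m] (S T : Matrix m n ℝ) :
    (S + T).rank ≤ S.rank + T.rank := by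
  rw [Matrix.rank, mulVecLin_add]
  exact (Submodule.finrank_mono (LinearMap.range_add_le _ _)).trans
    (Submodule.finrank_add_le_finrank_add_finrank _ _)

theorem rank_sum_le {m n ι : Type*} [Fintype n] [Finite m] (s : Finset ι) (S : ι → Matrix m n ℝ) :
    (∑ i ∈ s, S i).rank ≤ ∑ i ∈ s, (S i).rank :=
  Finset.le_sum_of_subadditive _ rank_zero.le rank_add_le s S

theorem rank_add_rank_eq_card_of_isUnit_add {n : Type*} [Fintype n] [DecidableEq n]
    {A E : Matrix n n ℝ} (hAE : A * E = 0) (hunit : IsUnit (A + E)) :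
    A.rank + E.rank = Fintype.card n :=
  le_antisymm (rank_add_rank_le_card_of_mul_eq_zero hAE)
    (rank_of_isUnit _ hunit ▸ rank_add_le A E)

theorem trace_mul_nonneg {n : Type*} [Fintype n] {S T : Matrix n n ℝ} (hS : 0 ≤ S) (hT : 0 ≤ T) :
    0 ≤ (S * T).trace := by
  classical
  obtain ⟨B, rfl⟩ := CStarAlgebra.nonneg_iff_eq_star_mul_self.1 hT
  rw [← Matrix.mul_assoc, trace_mul_comm, ← Matrix.mul_assoc]
  exact (star_right_conjugate_nonneg hS B).posSemidef.trace_nonneg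

theorem isStarProjection_iff_transpose {n : Type*} [Fintype n] {P : Matrix n n ℝ} :
    IsStarProjection P ↔ P * P = P ∧ Pᵀ = P := by
  rw [isStarProjection_iff, IsIdempotentElem, IsSelfAdjoint, star_eq_conjTranspose,
    conjTranspose_eq_transpose_of_trivial]

theorem rank_eq_trace_of_isIdempotentElem {m : Type*} [Fintype m] {P : Matrix m m ℝ}
    (hP : IsIdempotentElem P) : (P.rank : ℝ) = P.trace := by
  classical
  have h : IsIdempotentElem (toLin' P) := by
    rw [IsIdempotentElem, Module.End.mul_eq_comp, ← toLin'_mul, hP.eq]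
  rw [← trace_toLin'_eq, (LinearMap.IsIdempotentElem.isProj_range _ h).trace, Matrix.rank,
    toLin'_apply']

variable {m n : Type*} [Fintype m] [DecidableEq m] [Fintype n] [DecidableEq n] (M : Matrix m n ℝ)

theorem toEuclideanLin_colProj :
    toEuclideanLin (colProj M) = (LinearMap.range (toEuclideanLin M)).starProjection :=
  toEuclideanLin.apply_symm_apply _

theorem colProj_mul_self : colProj M * M = M := by
  refine toEuclideanLin.injective (LinearMap.ext fun x => ?_)
  rw [toLpLin_mul_same, LinearMap.comp_apply, toEuclideanLin_colProj]
  exact Submodule.starProjection_eq_self_iff.2 (LinearMap.mem_range_self _ x)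

theorem exists_colProj_eq_mul : ∃ Y : Matrix n m ℝ, colProj M = M * Y := by
  have hmem (j : m) : ∃ y, M *ᵥ y = (colProj M).col j := by
    obtain ⟨y, hy⟩ : toEuclideanLin (colProj M) (EuclideanSpace.single j 1) ∈
        LinearMap.range (toEuclideanLin M) := by
      rw [toEuclideanLin_colProj]
      exact Submodule.starProjection_apply_mem _ _
    exact ⟨WithLp.ofLp y, by simpa [toLpLin_apply] using congrArg WithLp.ofLp hy⟩
  choose y hy using hmem
  exact ⟨(of y)ᵀ, by ext i j; exact (congrFun (hy j) i).symm⟩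

theorem isStarProjection_colProj : IsStarProjection (colProj M) := by
  obtain ⟨Y, hY⟩ := exists_colProj_eq_mul M
  refine ⟨?_, colProj_isHermitian M⟩
  rw [IsIdempotentElem]
  nth_rw 2 [hY]
  rw [← Matrix.mul_assoc, colProj_mul_self, ← hY]

theorem trace_colProj : (colProj M).trace = M.rank := by
  obtain ⟨Y, hY⟩ := exists_colProj_eq_mul M
  rw [← rank_eq_trace_of_isIdempotentElem (isStarProjection_colProj M).isIdempotentElem,
    Nat.cast_inj]
  refine le_antisymm (hY ▸ rank_mul_le_left M Y) ?_
  conv_lhs => rw [← colProj_mul_self M]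
  exact rank_mul_le_left _ M

variable {M}

theorem colProj_eq_of_mul_eq {P : Matrix m m ℝ} (hP : P.IsHermitian) (hPM : P * M = M)
    {Y : Matrix n m ℝ} (hY : P = M * Y) : colProj M = P := by
  obtain ⟨Z, hZ⟩ := exists_colProj_eq_mul M
  calc colProj M = P * colProj M := by rw [hZ, ← Matrix.mul_assoc, hPM]
    _ = (colProj M * P)ᴴ := by
      rw [conjTranspose_mul, hP.eq, (colProj_isHermitian M).eq]
    _ = P := by rw [hY, ← Matrix.mul_assoc, colProj_mul_self, ← hY, hP.eq]

end Projections

section Majorization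

variable {n ι : Type*} [Fintype n] [DecidableEq n] [Fintype ι]

theorem sum_sub_le_trace_colProj_mul {D : ι → Matrix n n ℝ} (hD : ∀ i, 0 ≤ D i) (s : Finset ι)
    {θ : ℝ} (hθ : 0 ≤ θ) {m : ι → ℝ} (hrank : ∀ i, (D i).rank ≤ m i) :
    ∑ i ∈ s, ((D i).trace - θ * m i) ≤
      (colProj (∑ i ∈ s, D i) * (∑ i, D i - θ • 1)).trace := by
  set T := colProj (∑ i ∈ s, D i)
  have hT : IsStarProjection T := isStarProjection_colProj _
  have htr : T.trace ≤ ∑ i ∈ s, m i := by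
    rw [trace_colProj]
    calc ((∑ i ∈ s, D i).rank : ℝ) ≤ ∑ i ∈ s, ((D i).rank : ℝ) := mod_cast rank_sum_le s D
      _ ≤ ∑ i ∈ s, m i := Finset.sum_le_sum fun i _ => hrank i
  have hsum : ∑ i ∈ s, (D i).trace ≤ (T * ∑ i, D i).trace := by
    classical
    rw [← Finset.sum_add_sum_compl s, Matrix.mul_add, colProj_mul_self, trace_add, trace_sum]
    exact le_add_of_nonneg_right (trace_mul_nonneg hT.nonneg (Finset.sum_nonneg fun i _ => hD i))
  rw [Matrix.mul_sub, trace_sub, mul_smul_comm, Matrix.mul_one, trace_smul, smul_eq_mul,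
    Finset.sum_sub_distrib, ← Finset.mul_sum]
  exact sub_le_sub hsum (mul_le_mul_of_nonneg_left htr hθ)

theorem weaklyMajorizedFromAbove_of_eq_smul_one_sub_sum {A A' : Matrix n n ℝ}
    (hA : A.IsHermitian) (hA' : A'.IsHermitian) {c : ℝ} {D E : ι → Matrix n n ℝ} {r : ι → ℝ}
    (hAD : A = c • 1 - ∑ i, D i) (hAE : A' = c • 1 - ∑ i, r i • E i)
    (hD : ∀ i, 0 ≤ D i) (hE : ∀ i, 0 ≤ E i) (hE1 : ∑ i, E i ≤ 1)
    (hrank : ∀ i, (D i).rank ≤ (E i).trace) (htrace : ∀ i, (D i).trace = r i * (E i).trace) :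
    WeaklyMajorizedFromAbove (ascEigenvalues hA') (ascEigenvalues hA) := by
  intro k
  set μ := ascEigenvalues hA k
  set θ := c - μ with hθ_def
  have hθ : 0 ≤ θ := sub_nonneg.2 <| ascEigenvalues_le_of_le_smul_one hA
    (hAD ▸ sub_le_self _ (Finset.sum_nonneg fun i _ => hD i)) k
  let s : Finset ι := {i | θ < r i}
  set W := ∑ i, max (r i - θ) 0 • E i
  have hW : 0 ≤ W := Finset.sum_nonneg fun i _ => smul_nonneg (le_max_right _ _) (hE i)
  have hWtrace : W.trace = ∑ i ∈ s, ((D i).trace - θ * (E i).trace) := by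
    rw [trace_sum, Finset.sum_filter]
    refine Finset.sum_congr rfl fun i _ => ?_
    rw [trace_smul, smul_eq_mul, htrace]
    split_ifs with hi
    · rw [max_eq_left (sub_nonneg.2 hi.le), sub_mul]
    · rw [max_eq_right (sub_nonpos.2 (not_lt.1 hi)), zero_mul]
  have hlower : μ • 1 ≤ A' + W := by
    have hsub : A' + W - μ • 1 =
        θ • (1 - ∑ i, E i) + ∑ i, (max (r i - θ) 0 - (r i - θ)) • E i := by
      simp only [hAE, W, hθ_def, sub_smul, smul_sub, Finset.sum_sub_distrib, Finset.smul_sum]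
      abel
    rw [← sub_nonneg, hsub]
    exact add_nonneg (smul_nonneg hθ (sub_nonneg.2 hE1)) (Finset.sum_nonneg fun i _ =>
      smul_nonneg (sub_nonneg.2 (le_max_left _ _)) (hE i))
  have hT := isStarProjection_colProj (∑ i ∈ s, D i)
  have hAθ : A - μ • 1 = -(∑ i, D i - θ • 1) := by
    rw [hAD, hθ_def, sub_smul]
    abel
  calc ∑ i ∈ Finset.Iic k, ascEigenvalues hA i
      ≤ (k + 1) * μ + (colProj (∑ i ∈ s, D i) * (A - μ • 1)).trace :=
        sum_Iic_ascEigenvalues_le hA hT.nonneg hT.le_one k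
    _ ≤ (k + 1) * μ - W.trace := by
        rw [hAθ, Matrix.mul_neg, trace_neg, ← sub_eq_add_neg, hWtrace]
        exact sub_le_sub_left (sum_sub_le_trace_colProj_mul hD s hθ hrank) _
    _ ≤ ∑ i ∈ Finset.Iic k, ascEigenvalues hA' i := le_sum_Iic_ascEigenvalues hA' hW hlower k

end Majorization

section Averaging

variable (n : Type*) [Fintype n]

/-- The orthogonal projection `J / |n|` onto the constant vectors. -/
noncomputable def averaging : Matrix n n ℝ :=
  (Fintype.card n : ℝ)⁻¹ • of fun _ _ => 1

/-- The orthogonal projection `I - J / |n|` onto the vectors with zero sum. -/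
noncomputable def centering [DecidableEq n] : Matrix n n ℝ :=
  1 - averaging n

variable {n}

theorem averaging_apply (i j : n) : averaging n i j = (Fintype.card n : ℝ)⁻¹ := by
  simp [averaging]

theorem mul_averaging_apply {m : Type*} {M : Matrix m n ℝ} (i : m) (j : n) :
    (M * averaging n) i j = (Fintype.card n : ℝ)⁻¹ * ∑ k, M i k := by
  simp [Matrix.mul_apply, averaging_apply, ← Finset.sum_mul, mul_comm]

theorem isStarProjection_averaging [Nonempty n] : IsStarProjection (averaging n) := by
  refine isStarProjection_iff_transpose.2 ⟨?_, rfl⟩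
  ext i j
  simp [mul_averaging_apply, averaging_apply]

theorem isStarProjection_centering [DecidableEq n] [Nonempty n] :
    IsStarProjection (centering n) :=
  isStarProjection_averaging.one_sub

theorem trace_averaging [Nonempty n] : (averaging n).trace = 1 := by
  simp [Matrix.trace, averaging_apply]

theorem averaging_mul_averaging [Nonempty n] :
    averaging n * averaging n = (1 : ℝ) • averaging n := by
  rw [isStarProjection_averaging.isIdempotentElem.eq, one_smul]

theorem averaging_mul_centering [DecidableEq n] [Nonempty n] :
    averaging n * centering n = (0 : ℝ) • centering n := by
  rw [zero_smul]
  exact isStarProjection_averaging.mul_one_sub_self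

theorem averaging_add_centering [DecidableEq n] : averaging n + centering n = 1 :=
  add_sub_cancel _ _

end Averaging

theorem isStarProjection_kronecker {m n : Type*} [Fintype m] [Fintype n] {P : Matrix m m ℝ}
    {Q : Matrix n n ℝ} (hP : IsStarProjection P) (hQ : IsStarProjection Q) :
    IsStarProjection (P ⊗ₖ Q) := by
  rw [isStarProjection_iff_transpose] at *
  exact ⟨by rw [← mul_kronecker_mul, hP.1, hQ.1], by rw [← kroneckerMap_transpose, hP.2, hQ.2]⟩

section Strata

variable (L B : Type*) [Fintype L] [DecidableEq L] [Fintype B] [DecidableEq B]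

/-- The three strata of the levels of all block factors, as projections on `ℝ ^ (L × B)`: the
overall mean, the sum over the block factors of effects with zero sum, and the contrasts between
the block factors of such effects. The differences of the means of the block factors are left out,
as they do not affect the units. -/
noncomputable def stratum : Fin 3 → Matrix (L × B) (L × B) ℝ :=
  ![averaging L ⊗ₖ averaging B, centering L ⊗ₖ averaging B, centering L ⊗ₖ centering B]

variable {L B}

theorem isStarProjection_stratum [Nonempty L] [Nonempty B] (i : Fin 3) :
    IsStarProjection (stratum L B i) := by
  fin_cases i
  exacts [isStarProjection_kronecker isStarProjection_averaging isStarProjection_averaging,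
    isStarProjection_kronecker isStarProjection_centering isStarProjection_averaging,
    isStarProjection_kronecker isStarProjection_centering isStarProjection_centering]

theorem sum_stratum_add :
    ∑ i, stratum L B i + averaging L ⊗ₖ centering B = 1 := by
  rw [← one_kronecker_one, ← averaging_add_centering (n := L), ← averaging_add_centering (n := B)]
  simp only [Fin.sum_univ_three, stratum, Matrix.cons_val, add_kronecker, kronecker_add]
  abel

theorem sum_stratum_le_one [Nonempty L] [Nonempty B] : ∑ i, stratum L B i ≤ 1 := by
  rw [← sum_stratum_add, le_add_iff_nonneg_right]
  exact (isStarProjection_kronecker isStarProjection_averaging isStarProjection_centering).nonneg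

end Strata

section GramProjection

variable {m n : Type*} [Fintype m] [Fintype n] {X : Matrix m n ℝ} {G : Matrix n n ℝ} {κ : ℝ}

theorem isStarProjection_inv_smul_mul_mul_transpose (hG : IsStarProjection G)
    (hXG : Xᵀ * X * G = κ • G) (hκ : κ ≠ 0) : IsStarProjection (κ⁻¹ • (X * G * Xᵀ)) := by
  obtain ⟨hGG, hGt⟩ := isStarProjection_iff_transpose.1 hG
  refine isStarProjection_iff_transpose.2 ⟨?_, ?_⟩
  · calc κ⁻¹ • (X * G * Xᵀ) * κ⁻¹ • (X * G * Xᵀ)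
        = κ⁻¹ • κ⁻¹ • (X * G * (Xᵀ * X * G) * Xᵀ) := by
          simp only [Matrix.smul_mul, Matrix.mul_smul, Matrix.mul_assoc]
      _ = κ⁻¹ • (X * G * Xᵀ) := by
          rw [hXG, Matrix.mul_smul, Matrix.smul_mul, inv_smul_smul₀ hκ, Matrix.mul_assoc X, hGG]
  · simp only [transpose_smul, transpose_mul, transpose_transpose, hGt, Matrix.mul_assoc]

theorem trace_inv_smul_mul_mul_transpose (hXG : Xᵀ * X * G = κ • G) (hκ : κ ≠ 0) :
    (κ⁻¹ • (X * G * Xᵀ)).trace = G.trace := by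
  rw [trace_smul, trace_mul_comm, ← Matrix.mul_assoc, hXG, trace_smul, inv_smul_smul₀ hκ]

theorem inv_smul_mul_mul_transpose_mul (hG : IsStarProjection G) (hXG : Xᵀ * X * G = κ • G)
    (hκ : κ ≠ 0) : κ⁻¹ • (X * G * Xᵀ) * X = X * G := by
  obtain ⟨-, hGt⟩ := isStarProjection_iff_transpose.1 hG
  have hGX : G * (Xᵀ * X) = κ • G := by
    simpa [transpose_mul, hGt] using congrArg transpose hXG
  rw [Matrix.smul_mul, Matrix.mul_assoc, Matrix.mul_assoc, hGX, Matrix.mul_smul,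
    inv_smul_smul₀ hκ]

end GramProjection

namespace Setting

/-- The eigenvalue of `X'X` on each stratum, where `X` is the matrix of all block factors of a
uniform setting. -/
noncomputable def stratumEigenvalue (L B : Type*) [Fintype L] [Fintype B] : Fin 3 → ℝ :=
  ![Fintype.card B * (Fintype.card L - 1), Fintype.card L - Fintype.card B, Fintype.card L]

theorem stratumEigenvalue_ne_zero {L B : Type*} [Fintype L] [Fintype B] [Nonempty B]
    (hBL : Fintype.card B < Fintype.card L) (i : Fin 3) : stratumEigenvalue L B i ≠ 0 := by
  have hB : (1 : ℝ) ≤ Fintype.card B := mod_cast Fintype.card_pos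
  have hBL' : (Fintype.card B : ℝ) < Fintype.card L := mod_cast hBL
  fin_cases i
  exacts [(mul_pos (by linarith) (by linarith)).ne', (sub_pos.2 hBL').ne', by
    simpa [stratumEigenvalue] using by linarith]

variable {U B L : Type*} [Fintype L] [DecidableEq L]

/-- The matrix of all block factors: the columns of the matrices `X_A` side by side. -/
def blockColumns (σ : Setting U B L) : Matrix U (L × B) ℝ :=
  of fun u lA => σ.blockMatrix lA.2 u lA.1

/-- With `s` the number of levels of each block factor, every level of each block factor occurs on
`s - 1` units and `M_{AA'} = J_s - I_s` for any two distinct block factors. -/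
def IsUniform [Fintype U] (σ : Setting U B L) : Prop :=
  (∀ A, σ.incidence A A = (Fintype.card L - 1 : ℝ) • 1) ∧
    ∀ A A', A ≠ A' → σ.incidence A A' = of (fun _ _ => 1) - 1

variable [Fintype B]

theorem blockColumns_mul_apply {m : Type*} (σ : Setting U B L) (T : Matrix (L × B) m ℝ) (u : U)
    (j : m) : (σ.blockColumns * T) u j = ∑ A, T (σ.level u A, A) j := by
  simp [blockColumns, blockMatrix, designMatrix, Matrix.mul_apply, Fintype.sum_prod_type_right]

theorem blockColumns_mul_const [Nonempty B] (σ : Setting U B L) :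
    σ.blockColumns * (of fun _ _ => (Fintype.card B : ℝ)⁻¹ : Matrix (L × B) Unit ℝ) =
      of fun _ _ => 1 := by
  ext u j
  simp [blockColumns_mul_apply]

/-- The orthogonal projection onto the image of a stratum in the space of the units. -/
noncomputable def stratumProj [DecidableEq B] (σ : Setting U B L) (i : Fin 3) : Matrix U U ℝ :=
  (stratumEigenvalue L B i)⁻¹ • (σ.blockColumns * stratum L B i * σ.blockColumnsᵀ)

namespace IsUniform

variable [Fintype U] {σ : Setting U B L}

theorem blockColumns_transpose_mul_self [DecidableEq B] [Nonempty B] [Nonempty L]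
    (hσ : σ.IsUniform) :
    σ.blockColumnsᵀ * σ.blockColumns =
      ((Fintype.card L : ℝ) • averaging L - 1) ⊗ₖ ((Fintype.card B : ℝ) • averaging B) +
        (Fintype.card L : ℝ) • centering L ⊗ₖ (1 : Matrix B B ℝ) := by
  ext ⟨l, A⟩ ⟨l', A'⟩
  have hincidence : (σ.blockColumnsᵀ * σ.blockColumns) (l, A) (l', A') =
      σ.incidence A A' l l' := rfl
  have hcardB : (Fintype.card B : ℝ) ≠ 0 := Nat.cast_ne_zero.2 Fintype.card_ne_zero
  rw [hincidence]
  rcases eq_or_ne A A' with rfl | hA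
  · simp only [hσ.1, centering, averaging_apply, Matrix.add_apply, Matrix.sub_apply,
      Matrix.smul_apply, kroneckerMap_apply, Matrix.one_apply_eq, smul_eq_mul,
      mul_inv_cancel₀ hcardB]
    ring
  · simp [hσ.2 A A' hA, hA, averaging_apply]

theorem blockColumns_transpose_mul_self_mul_kronecker [Nonempty B] [Nonempty L]
    (hσ : σ.IsUniform) {Q : Matrix L L ℝ} {P : Matrix B B ℝ} {γ β : ℝ}
    (hQ : averaging L * Q = γ • Q) (hP : averaging B * P = β • P) :
    σ.blockColumnsᵀ * σ.blockColumns * Q ⊗ₖ P =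
      (Fintype.card B * β * (Fintype.card L * γ - 1) + Fintype.card L * (1 - γ)) • Q ⊗ₖ P := by
  classical
  have hQ' : centering L * Q = (1 - γ) • Q := by
    rw [centering, Matrix.sub_mul, hQ, Matrix.one_mul, sub_smul, one_smul]
  have hQ'' : ((Fintype.card L : ℝ) • averaging L - 1) * Q = (Fintype.card L * γ - 1) • Q := by
    rw [Matrix.sub_mul, Matrix.smul_mul, hQ, Matrix.one_mul, sub_smul, one_smul, smul_smul]
  rw [hσ.blockColumns_transpose_mul_self, Matrix.add_mul, Matrix.smul_mul, ← mul_kronecker_mul,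
    ← mul_kronecker_mul, Matrix.smul_mul, hP, Matrix.one_mul, hQ', hQ'']
  simp only [smul_kronecker, kronecker_smul, smul_smul, ← add_smul]

variable [DecidableEq B]

theorem blockColumns_transpose_mul_self_mul_stratum [Nonempty B] [Nonempty L] (hσ : σ.IsUniform)
    (i : Fin 3) :
    σ.blockColumnsᵀ * σ.blockColumns * stratum L B i = stratumEigenvalue L B i • stratum L B i := by
  have hB := averaging_mul_averaging (n := B)
  have hL := averaging_mul_averaging (n := L)
  fin_cases i
  · simpa [stratum, stratumEigenvalue]
      using hσ.blockColumns_transpose_mul_self_mul_kronecker hL hB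
  · simpa [stratum, stratumEigenvalue, neg_add_eq_sub]
      using hσ.blockColumns_transpose_mul_self_mul_kronecker averaging_mul_centering hB
  · simpa [stratum, stratumEigenvalue] using hσ.blockColumns_transpose_mul_self_mul_kronecker
      averaging_mul_centering averaging_mul_centering

theorem blockColumns_mul_sum_stratum [Nonempty B] [Nonempty L] (hσ : σ.IsUniform) :
    σ.blockColumns * ∑ i, stratum L B i = σ.blockColumns := by
  have hzero : σ.blockColumns * averaging L ⊗ₖ centering B = 0 := by
    rw [← conjTranspose_mul_self_mul_eq_zero, conjTranspose_eq_transpose_of_trivial,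
      hσ.blockColumns_transpose_mul_self_mul_kronecker averaging_mul_averaging
        averaging_mul_centering]
    simp
  rw [← add_zero (σ.blockColumns * _), ← hzero, ← Matrix.mul_add, sum_stratum_add, Matrix.mul_one]

variable [Nonempty B]

theorem isStarProjection_stratumProj (hσ : σ.IsUniform)
    (hBL : Fintype.card B < Fintype.card L) (i : Fin 3) :
    IsStarProjection (σ.stratumProj i) := by
  have : Nonempty L := Fintype.card_pos_iff.1 (Nat.zero_lt_of_lt hBL)
  exact isStarProjection_inv_smul_mul_mul_transpose (isStarProjection_stratum i)
    (hσ.blockColumns_transpose_mul_self_mul_stratum i) (stratumEigenvalue_ne_zero hBL i)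

theorem trace_stratumProj (hσ : σ.IsUniform) (hBL : Fintype.card B < Fintype.card L)
    (i : Fin 3) : (σ.stratumProj i).trace = (stratum L B i).trace := by
  have : Nonempty L := Fintype.card_pos_iff.1 (Nat.zero_lt_of_lt hBL)
  exact trace_inv_smul_mul_mul_transpose (hσ.blockColumns_transpose_mul_self_mul_stratum i)
    (stratumEigenvalue_ne_zero hBL i)

theorem sum_stratumProj_mul_blockColumns (hσ : σ.IsUniform)
    (hBL : Fintype.card B < Fintype.card L) :
    (∑ i, σ.stratumProj i) * σ.blockColumns = σ.blockColumns := by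
  have : Nonempty L := Fintype.card_pos_iff.1 (Nat.zero_lt_of_lt hBL)
  calc (∑ i, σ.stratumProj i) * σ.blockColumns
      = ∑ i, σ.blockColumns * stratum L B i := by
        rw [Matrix.sum_mul]
        exact Finset.sum_congr rfl fun i _ =>
          inv_smul_mul_mul_transpose_mul (isStarProjection_stratum i)
            (hσ.blockColumns_transpose_mul_self_mul_stratum i) (stratumEigenvalue_ne_zero hBL i)
    _ = σ.blockColumns := by rw [← Matrix.mul_sum, hσ.blockColumns_mul_sum_stratum]

theorem colProj_nuisanceMatrix [DecidableEq U] (hσ : σ.IsUniform)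
    (hBL : Fintype.card B < Fintype.card L) :
    colProj σ.nuisanceMatrix = ∑ i, σ.stratumProj i := by
  have hX := hσ.sum_stratumProj_mul_blockColumns hBL
  have hM : σ.nuisanceMatrix =
      fromCols (of fun _ _ => 1) (σ.blockColumns.submatrix id (Equiv.prodComm B L)) := rfl
  refine colProj_eq_of_mul_eq (Y := fromRows 0 ((∑ i, (stratumEigenvalue L B i)⁻¹ •
    (stratum L B i * σ.blockColumnsᵀ)).submatrix (Equiv.prodComm B L) id)) ?_ ?_ ?_
  · exact isSelfAdjoint_sum _ fun i _ => (hσ.isStarProjection_stratumProj hBL i).isSelfAdjoint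
  · rw [hM, mul_fromCols, ← blockColumns_mul_const σ, ← Matrix.mul_assoc, hX]
    exact congrArg (fromCols _) (congrArg (submatrix · id (Equiv.prodComm B L)) hX)
  · rw [hM, fromCols_mul_fromRows, Matrix.mul_zero, zero_add, submatrix_mul_equiv, submatrix_id_id,
      Matrix.mul_sum]
    simp only [stratumProj, Matrix.mul_smul, Matrix.mul_assoc]

end IsUniform

end Setting

theorem designMatrix_transpose_mul_apply {U S S' : Type*} [Fintype U] [DecidableEq S]
    [DecidableEq S'] (f : U → S) (g : U → S') (p : S) (q : S') :
    ((designMatrix f)ᵀ * designMatrix g) p q =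
      (({u | f u = p ∧ g u = q} : Finset U).card : ℝ) := by
  simp [designMatrix, Matrix.mul_apply, Finset.card_filter, ite_and, and_comm (a := f _ = p)]

theorem trace_mul_transpose_of_binary {m n : Type*} [Fintype m] [Fintype n] {N : Matrix m n ℝ}
    {c : ℝ} (hb : ∀ i j, N i j = 0 ∨ N i j = 1) (hN : ∀ i, ∑ j, N i j = c) :
    (N * Nᵀ).trace = Fintype.card m * c := by
  have hsq (i j) : N i j * N i j = N i j := by rcases hb i j with h | h <;> simp [h]
  simp [Matrix.trace, Matrix.mul_apply, hsq, hN]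

theorem mul_averaging_mul_transpose {m n : Type*} [Fintype n] {M N : Matrix m n ℝ} {c : ℝ}
    (hM : ∀ i, ∑ j, M i j = c) (hN : ∀ i, ∑ j, N i j = c) :
    M * averaging n * Nᵀ = (c ^ 2 / Fintype.card n) • of fun _ _ => 1 := by
  ext i j
  rw [Matrix.mul_apply]
  simp only [mul_averaging_apply, hM, transpose_apply, ← Finset.mul_sum, hN, Matrix.smul_apply,
    of_apply, smul_eq_mul]
  ring

theorem trace_mul_averaging_mul_transpose {m n : Type*} [Fintype m] [Fintype n]
    {N : Matrix m n ℝ} {c : ℝ} (hN : ∀ i, ∑ j, N i j = c) :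
    (N * averaging n * Nᵀ).trace = Fintype.card m * (c ^ 2 / Fintype.card n) := by
  rw [mul_averaging_mul_transpose hN hN]
  simp [Matrix.trace]

theorem trace_mul_centering_mul_transpose_of_binary {m n : Type*} [Fintype m] [Fintype n]
    [DecidableEq n] {N : Matrix m n ℝ} {c : ℝ} (hb : ∀ i j, N i j = 0 ∨ N i j = 1)
    (hN : ∀ i, ∑ j, N i j = c) :
    (N * centering n * Nᵀ).trace = Fintype.card m * (c - c ^ 2 / Fintype.card n) := by
  rw [centering, Matrix.mul_sub, Matrix.sub_mul, trace_sub, Matrix.mul_one,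
    trace_mul_transpose_of_binary hb hN, trace_mul_averaging_mul_transpose hN, mul_sub]

namespace Design

variable {U B L V : Type*} {σ : Setting U B L} [Fintype U] [DecidableEq V]

section Component

/-- The part `X_V' P X_V` of the treatment information that is lost to the factors onto whose
space `P` projects. -/
def component (d : Design σ V) (P : Matrix U U ℝ) : Matrix V V ℝ :=
  d.treatmentMatrixᵀ * P * d.treatmentMatrix

theorem component_sum {ι : Type*} (d : Design σ V) (s : Finset ι) (P : ι → Matrix U U ℝ) :
    d.component (∑ i ∈ s, P i) = ∑ i ∈ s, d.component (P i) := by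
  simp only [component, Matrix.mul_sum, Matrix.sum_mul]

theorem component_nonneg [Finite V] (d : Design σ V) {P : Matrix U U ℝ} (hP : 0 ≤ P) :
    0 ≤ d.component P := by
  have h := hP.posSemidef.conjTranspose_mul_mul_same d.treatmentMatrix
  rw [conjTranspose_eq_transpose_of_trivial] at h
  exact h.nonneg

theorem rank_component_le [Fintype V] (d : Design σ V) {P : Matrix U U ℝ}
    (hP : IsStarProjection P) : (d.component P).rank ≤ P.trace := by
  classical
  rw [← rank_eq_trace_of_isIdempotentElem hP.isIdempotentElem, Nat.cast_le]
  exact (rank_mul_le_left _ _).trans (rank_mul_le_right _ _)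

end Component

section Replication

/-- Every treatment occurs on exactly `r` units. -/
def HasReplication (d : Design σ V) (r : ℕ) : Prop :=
  ∀ p : V, ({u | d.treatment u = p} : Finset U).card = r

variable {d : Design σ V} {r : ℕ}

theorem HasReplication.card_eq [Fintype V] (hd : d.HasReplication r) :
    Fintype.card U = Fintype.card V * r := by
  rw [← Finset.card_univ, Finset.card_eq_sum_card_fiberwise (f := d.treatment)
    (t := Finset.univ) fun _ _ => Finset.mem_coe.2 (Finset.mem_univ _)]
  simp [hd _]

theorem Equireplicate.hasReplication [Fintype V] [Nonempty V] (hd : d.Equireplicate)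
    (hU : Fintype.card U = Fintype.card V * r) : d.HasReplication r := by
  obtain ⟨r', hr'⟩ := hd
  have h : Fintype.card V * r' = Fintype.card V * r := (HasReplication.card_eq hr').symm.trans hU
  exact Nat.eq_of_mul_eq_mul_left Fintype.card_pos h ▸ hr'

theorem HasReplication.treatmentMatrix_transpose_mul_self (hd : d.HasReplication r) :
    d.treatmentMatrixᵀ * d.treatmentMatrix = (r : ℝ) • 1 := by
  ext p q
  rw [treatmentMatrix, designMatrix_transpose_mul_apply]
  rcases eq_or_ne p q with rfl | hpq
  · simp [hd p]
  · simp +contextual [hpq]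

end Replication

section CMatrix

variable [DecidableEq U] [Fintype B] [DecidableEq B] [Fintype L] [DecidableEq L] {ι : Type*}
  [Fintype ι] {P : ι → Matrix U U ℝ} {d d' : Design σ V} {r : ℕ}

theorem HasReplication.cMatrix_eq (hd : d.HasReplication r)
    (hP : colProj σ.nuisanceMatrix = ∑ i, P i) :
    d.cMatrix = (r : ℝ) • 1 - ∑ i, d.component (P i) := by
  rw [cMatrix, Matrix.mul_sub, Matrix.sub_mul, Matrix.mul_one,
    hd.treatmentMatrix_transpose_mul_self, hP, ← component_sum, component]

theorem HasReplication.mBetter_of_component_eq_smul [Fintype V] {E : ι → Matrix V V ℝ} {c : ι → ℝ}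
    (hd : d.HasReplication r) (hd' : d'.HasReplication r)
    (hP : colProj σ.nuisanceMatrix = ∑ i, P i) (hPproj : ∀ i, IsStarProjection (P i))
    (hE : ∀ i, 0 ≤ E i) (hE1 : ∑ i, E i ≤ 1) (htr : ∀ i, (E i).trace = (P i).trace)
    (hdE : ∀ i, d.component (P i) = c i • E i)
    (hdd' : ∀ i, (d'.component (P i)).trace = (d.component (P i)).trace) : d.MBetter d' := by
  refine weaklyMajorizedFromAbove_of_eq_smul_one_sub_sum d'.cMatrix_isHermitian
    d.cMatrix_isHermitian (hd'.cMatrix_eq hP) (E := E) (r := c) ?_ ?_ hE hE1 ?_ ?_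
  · rw [hd.cMatrix_eq hP]
    simp only [hdE]
  · exact fun i => d'.component_nonneg (hPproj i).nonneg
  · exact fun i => htr i ▸ d'.rank_component_le (hPproj i)
  · exact fun i => by rw [hdd', hdE, trace_smul, smul_eq_mul]

end CMatrix

section Incidence

variable [DecidableEq L] {d d' : Design σ V} {r : ℕ}

theorem incidence_apply (d : Design σ V) (A : B) (p : V) (l : L) :
    d.incidence A p l =
      (({u | d.treatment u = p ∧ σ.level u A = l} : Finset U).card : ℝ) :=
  designMatrix_transpose_mul_apply _ _ p l

theorem HasReplication.sum_incidence [Fintype L] (hd : d.HasReplication r) (A : B) (p : V) :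
    ∑ l, d.incidence A p l = r := by
  simp only [incidence_apply, ← Finset.filter_filter]
  rw [← hd p, Finset.card_eq_sum_card_fiberwise (f := fun u => σ.level u A)
    (t := Finset.univ) fun _ _ => Finset.mem_coe.2 (Finset.mem_univ _)]
  push_cast
  rfl

variable [Fintype B]

theorem HasReplication.sum_totalIncidence [Fintype L] (hd : d.HasReplication r) (p : V) :
    ∑ l, d.totalIncidence p l = Fintype.card B * r := by
  simp only [totalIncidence, Matrix.sum_apply]
  rw [Finset.sum_comm]
  simp [hd.sum_incidence]

theorem TotallyBinary.incidence (hd : d.TotallyBinary) (A : B) (p : V) (l : L) :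
    d.incidence A p l = 0 ∨ d.incidence A p l = 1 := by
  have hle : d.incidence A p l ≤ d.totalIncidence p l := by
    rw [totalIncidence, Matrix.sum_apply]
    exact Finset.single_le_sum (f := fun A => d.incidence A p l)
      (fun A' _ => (d.incidence_apply A' p l).ge.trans' (Nat.cast_nonneg _)) (Finset.mem_univ A)
  have hone : d.totalIncidence p l ≤ 1 := by rcases hd p l with h | h <;> simp [h]
  rw [incidence_apply] at hle ⊢
  exact_mod_cast Nat.le_one_iff_eq_zero_or_eq_one.1 (mod_cast hle.trans hone)

end Incidence

section Strata

variable [Fintype B] [Fintype L] [DecidableEq L] {d d' : Design σ V} {r : ℕ}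

theorem component_blockColumns_mul_kronecker (d : Design σ V) (Q : Matrix L L ℝ)
    (P : Matrix B B ℝ) :
    d.component (σ.blockColumns * Q ⊗ₖ P * σ.blockColumnsᵀ) =
      ∑ A, ∑ A', P A A' • (d.incidence A * Q * (d.incidence A')ᵀ) := by
  have hN (A) : d.incidence A = d.treatmentMatrixᵀ * σ.blockMatrix A := rfl
  have hX : σ.blockColumns * Q ⊗ₖ P * σ.blockColumnsᵀ =
      ∑ A, ∑ A', P A A' • (σ.blockMatrix A * Q * (σ.blockMatrix A')ᵀ) := by
    ext u w
    have hM (A : B) (M : Matrix L U ℝ) : (σ.blockMatrix A * M) u w = M (σ.level u A) w := by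
      simp [Setting.blockMatrix, designMatrix, Matrix.mul_apply]
    have hM' (A A' : B) : (Q * (σ.blockMatrix A')ᵀ) (σ.level u A) w =
        Q (σ.level u A) (σ.level w A') := by
      simp [Setting.blockMatrix, designMatrix, Matrix.mul_apply]
    simp only [Matrix.mul_assoc, Setting.blockColumns_mul_apply, Matrix.sum_apply,
      Matrix.smul_apply, hM, hM', smul_eq_mul]
    refine Finset.sum_congr rfl fun A _ => ?_
    simp [Setting.blockColumns, Setting.blockMatrix, designMatrix, Matrix.mul_apply,
      Fintype.sum_prod_type_right, mul_comm]
  simp only [hX, component, hN, Matrix.mul_sum, Matrix.sum_mul, transpose_mul, transpose_transpose,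
    Matrix.mul_smul, Matrix.smul_mul, Matrix.mul_assoc]

theorem component_kronecker_one [DecidableEq B] (d : Design σ V) (Q : Matrix L L ℝ) :
    d.component (σ.blockColumns * Q ⊗ₖ (1 : Matrix B B ℝ) * σ.blockColumnsᵀ) =
      ∑ A, d.incidence A * Q * (d.incidence A)ᵀ := by
  simp [component_blockColumns_mul_kronecker, Matrix.one_apply]

theorem component_kronecker_averaging (d : Design σ V) (Q : Matrix L L ℝ) :
    d.component (σ.blockColumns * Q ⊗ₖ averaging B * σ.blockColumnsᵀ) =
      (Fintype.card B : ℝ)⁻¹ • (d.totalIncidence * Q * d.totalIncidenceᵀ) := by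
  simp only [component_blockColumns_mul_kronecker, averaging_apply, totalIncidence, Matrix.sum_mul,
    transpose_sum, Matrix.mul_sum, Finset.smul_sum]
  exact Finset.sum_comm

variable [DecidableEq B]

theorem component_stratumProj (d : Design σ V) (i : Fin 3) :
    d.component (σ.stratumProj i) = (Setting.stratumEigenvalue L B i)⁻¹ •
      ![(Fintype.card B : ℝ)⁻¹ • (d.totalIncidence * averaging L * d.totalIncidenceᵀ),
        (Fintype.card B : ℝ)⁻¹ • (d.totalIncidence * centering L * d.totalIncidenceᵀ),
        ∑ A, d.incidence A * centering L * (d.incidence A)ᵀ -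
          (Fintype.card B : ℝ)⁻¹ • (d.totalIncidence * centering L * d.totalIncidenceᵀ)] i := by
  have hsmul (κ : ℝ) (P : Matrix U U ℝ) : d.component (κ • P) = κ • d.component P := by
    simp only [component, Matrix.mul_smul, Matrix.smul_mul]
  rw [Setting.stratumProj, hsmul]
  congr 1
  fin_cases i
  · exact d.component_kronecker_averaging _
  · exact d.component_kronecker_averaging _
  · refine eq_sub_of_add_eq ?_
    rw [← component_kronecker_averaging, ← component_kronecker_one,
      ← averaging_add_centering (n := B)]
    simp [stratum, component, kronecker_add, Matrix.mul_add, Matrix.add_mul, add_comm]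

theorem HasReplication.trace_component_stratumProj_eq [Fintype V] (hd : d.HasReplication r)
    (hd' : d'.HasReplication r) (hb : d.TotallyBinary) (hb' : d'.TotallyBinary) (i : Fin 3) :
    (d'.component (σ.stratumProj i)).trace = (d.component (σ.stratumProj i)).trace := by
  simp only [component_stratumProj, trace_smul]
  congr 1
  fin_cases i <;>
    simp [trace_smul, trace_sub, trace_sum,
      trace_mul_averaging_mul_transpose hd.sum_totalIncidence,
      trace_mul_averaging_mul_transpose hd'.sum_totalIncidence,
      trace_mul_centering_mul_transpose_of_binary hb hd.sum_totalIncidence,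
      trace_mul_centering_mul_transpose_of_binary hb' hd'.sum_totalIncidence,
      fun A => trace_mul_centering_mul_transpose_of_binary (hb.incidence A) (hd.sum_incidence A),
      fun A => trace_mul_centering_mul_transpose_of_binary (hb'.incidence A) (hd'.sum_incidence A)]

end Strata

end Design

section CosetIndicator

variable {F : Type*} [Field F] {h : ℕ} {C₀ : Subgroup Fˣ}

theorem card_eq_mul_card_subgroup_add_one [Fintype F]
    (C : Multiplicative (ZMod h) ≃* Fˣ ⧸ C₀) :
    Fintype.card F = h * Nat.card C₀ + 1 := by
  rw [← Nat.card_zmod h, Nat.card_congr Multiplicative.ofAdd, Nat.card_congr C.toEquiv,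
    ← Subgroup.card_eq_card_quotient_mul_card_subgroup, Nat.card_units, Nat.card_eq_fintype_card,
    Nat.sub_add_cancel Fintype.card_pos]

theorem card_zmod_lt_card [Fintype F] [NeZero h]
    (C : Multiplicative (ZMod h) ≃* Fˣ ⧸ C₀) :
    Fintype.card (ZMod h) < Fintype.card F := by
  rw [ZMod.card, card_eq_mul_card_subgroup_add_one C, Nat.lt_succ_iff]
  exact Nat.le_mul_of_pos_right h Nat.card_pos

variable (C : Multiplicative (ZMod h) ≃* Fˣ ⧸ C₀)

/-- The index `i` of the coset `C_i` containing a unit. -/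
def cosetIndex (a : Fˣ) : ZMod h :=
  (C.symm (a : Fˣ ⧸ C₀)).toAdd

theorem cosetIndex_mul (a b : Fˣ) : cosetIndex C (a * b) = cosetIndex C a + cosetIndex C b := by
  simp [cosetIndex]

theorem cosetIndex_one : cosetIndex C 1 = 0 := by
  simp [cosetIndex]

theorem cosetIndex_div (a b : Fˣ) : cosetIndex C (a / b) = cosetIndex C a - cosetIndex C b := by
  rw [eq_sub_iff_add_eq, ← cosetIndex_mul, div_mul_cancel]

theorem cosetIndex_eq_iff (a : Fˣ) (i : ZMod h) :
    cosetIndex C a = i ↔ (a : Fˣ ⧸ C₀) = C (Multiplicative.ofAdd i) :=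
  C.symm_apply_eq

theorem card_cosetIndex_eq [Fintype Fˣ] (i : ZMod h) :
    ({a : Fˣ | cosetIndex C a = i} : Finset Fˣ).card = Nat.card C₀ := by
  obtain ⟨g, hg⟩ := QuotientGroup.mk_surjective (C (Multiplicative.ofAdd i))
  rw [← Fintype.card_subtype, ← Nat.card_eq_fintype_card]
  refine Nat.card_congr ⟨fun a => ⟨g⁻¹ * a, ?_⟩, fun c => ⟨g * c, ?_⟩, fun a => ?_, fun c => ?_⟩
  · rw [← QuotientGroup.eq, hg, ← (cosetIndex_eq_iff C a i).1 a.2]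
  · rw [cosetIndex_eq_iff, ← hg]
    exact QuotientGroup.mk_mul_of_mem g c.2
  · simp
  · simp

variable [DecidableEq F]

/-- The indicator function of the coset `C_i` on the whole field; it vanishes at `0`. -/
def cosetIndicator (i : ZMod h) (x : F) : ℝ :=
  if hx : x = 0 then 0 else if cosetIndex C (Units.mk0 x hx) = i then 1 else 0

@[simp]
theorem cosetIndicator_zero (i : ZMod h) : cosetIndicator C i 0 = 0 :=
  dif_pos rfl

@[simp]
theorem cosetIndicator_coe (i : ZMod h) (a : Fˣ) :
    cosetIndicator C i a = if cosetIndex C a = i then 1 else 0 := by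
  simp [cosetIndicator]

theorem cosetIndicator_one (i : ZMod h) : cosetIndicator C i 1 = if i = 0 then 1 else 0 := by
  simpa [cosetIndex_one, eq_comm] using cosetIndicator_coe C i 1

theorem cosetIndicator_eq_card [Fintype Fˣ] (i : ZMod h) (x : F) :
    cosetIndicator C i x = (({a : Fˣ | cosetIndex C a = i ∧ a = x} : Finset Fˣ).card : ℝ) := by
  rcases eq_or_ne x 0 with rfl | hx
  · simp
  · lift x to Fˣ using hx.isUnit
    simp [Finset.card_filter, ite_and, Units.val_inj, and_comm (a := cosetIndex C _ = i)]

theorem sum_cosetIndicator_mul [NeZero h] (j k : ZMod h) (x y : F) :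
    ∑ A, cosetIndicator C (j + A) x * cosetIndicator C (k + A) y =
      cosetIndicator C (j - k) (x / y) := by
  rcases eq_or_ne x 0 with rfl | hx
  · simp
  rcases eq_or_ne y 0 with rfl | hy
  · simp
  lift x to Fˣ using hx.isUnit
  lift y to Fˣ using hy.isUnit
  rw [← Units.val_div_eq_div_val]
  simp only [cosetIndicator_coe, ← sub_eq_iff_eq_add', cosetIndex_div, ite_mul, one_mul, zero_mul,
    Finset.sum_ite_eq, Finset.mem_univ, if_true]
  exact if_congr ⟨fun hyx => by linear_combination -hyx, fun hyx => by linear_combination -hyx⟩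
    rfl rfl

theorem sum_cosetIndicator_add_left [NeZero h] (j : ZMod h) (x : F) :
    ∑ A, cosetIndicator C (j + A) x = if x = 0 then 0 else 1 := by
  split_ifs with hx
  · simp [hx]
  · lift x to Fˣ using isUnit_iff_ne_zero.2 hx
    simp [← sub_eq_iff_eq_add']

variable [Fintype F]

theorem sum_cosetIndicator (i : ZMod h) : ∑ x : F, cosetIndicator C i x = Nat.card C₀ := by
  rw [← card_cosetIndex_eq C i, Finset.card_eq_sum_card_fiberwise (f := Units.val)
    (t := Finset.univ) fun _ _ => Finset.mem_coe.2 (Finset.mem_univ _)]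
  simp [cosetIndicator_eq_card, Finset.filter_filter]

theorem sum_cosetIndicator_div_self (i : ZMod h) (x : F) :
    ∑ l, cosetIndicator C i ((l - x) / (l - x)) =
      if i = 0 then (Fintype.card F - 1 : ℝ) else 0 := by
  have hdiv (l : F) : cosetIndicator C i ((l - x) / (l - x)) =
      cosetIndicator C i 1 - if l = x then cosetIndicator C i 1 else 0 := by
    split_ifs with hl
    · simp [hl]
    · rw [div_self (sub_ne_zero.2 hl), sub_zero]
  simp only [hdiv, Finset.sum_sub_distrib, Finset.sum_const, Finset.sum_ite_eq', Finset.mem_univ,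
    if_true, cosetIndicator_one, Finset.card_univ, nsmul_eq_mul]
  split_ifs <;> simp

theorem sum_cosetIndicator_div_of_ne (i : ZMod h) {x y : F} (hxy : x ≠ y) :
    ∑ l, cosetIndicator C i ((l - x) / (l - y)) = Nat.card C₀ - if i = 0 then 1 else 0 := by
  -- `(l - x) / (l - y) = 1 + (y - x) / (l - y)`, and the right-hand side, with its junk value `1`
  -- at `l = y`, is a permutation of the field.
  let e : F ≃ F := ((Equiv.subRight y).trans (Equiv.inv F)).trans
    ((Equiv.mulLeft₀ (y - x) (sub_ne_zero.2 hxy.symm)).trans (Equiv.addLeft 1))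
  have he (l : F) : cosetIndicator C i ((l - x) / (l - y)) =
      cosetIndicator C i (e l) - if l = y then cosetIndicator C i 1 else 0 := by
    change _ = cosetIndicator C i (1 + (y - x) * (l - y)⁻¹) - _
    split_ifs with hl
    · simp [hl]
    · rw [sub_zero, ← div_eq_mul_inv, one_add_div (sub_ne_zero.2 hl), sub_add_sub_cancel]
  simp only [he, Finset.sum_sub_distrib, Equiv.sum_comp e (cosetIndicator C i), sum_cosetIndicator,
    Finset.sum_ite_eq', Finset.mem_univ, if_true, cosetIndicator_one]

end CosetIndicator

section Connectedness

variable {U B L V : Type*} {σ : Setting U B L} [Fintype U] [DecidableEq U] [Fintype B]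
  [DecidableEq B] [Fintype L] [DecidableEq L] [Fintype V] [DecidableEq V]

theorem Design.cMatrix_mul_averaging (d : Design σ V) : d.cMatrix * averaging V = 0 := by
  have hones : d.treatmentMatrix * (of fun _ _ => 1 : Matrix V V ℝ) = of fun _ _ => 1 := by
    ext u p
    simp [treatmentMatrix, designMatrix, Matrix.mul_apply]
  have hproj : colProj σ.nuisanceMatrix * (of fun _ _ => 1 : Matrix U V ℝ) = of fun _ _ => 1 := by
    ext u p
    simpa [Matrix.mul_apply, Setting.nuisanceMatrix]
      using congrFun₂ (colProj_mul_self σ.nuisanceMatrix) u (Sum.inl ())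
  rw [averaging, Matrix.mul_smul, cMatrix, Matrix.mul_assoc, hones, Matrix.mul_assoc,
    Matrix.sub_mul, hproj, Matrix.one_mul, sub_self, Matrix.mul_zero, smul_zero]

theorem Design.connected_of_isUnit [Nonempty V] (d : Design σ V) {c : ℝ}
    (hunit : IsUnit (d.cMatrix + c • averaging V)) (hc : c ≠ 0) : d.Connected := by
  have hrank := rank_add_rank_eq_card_of_isUnit_add
    (by rw [Matrix.mul_smul, d.cMatrix_mul_averaging, smul_zero]) hunit
  have hrank_averaging : ((averaging V).rank : ℝ) = 1 :=
    (rank_eq_trace_of_isIdempotentElem isStarProjection_averaging.isIdempotentElem).trans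
      trace_averaging
  rwa [rank_smul_of_mem_nonZeroDivisors _ (mem_nonZeroDivisors_of_ne_zero hc),
    Nat.cast_eq_one.1 hrank_averaging] at hrank

end Connectedness

theorem averaging_kronecker_averaging (m n : Type*) [Fintype m] [Fintype n] :
    averaging m ⊗ₖ averaging n = averaging (m × n) := by
  ext
  simp [averaging_apply, mul_comm]

section DOne

variable {F : Type*} [Field F] [Fintype F] [DecidableEq F] {h : ℕ} {C₀ : Subgroup Fˣ}
  {C : Multiplicative (ZMod h) ≃* Fˣ ⧸ C₀} {p : ZMod h → Fˣ}

theorem settingOne_incidence_apply (A A' : ZMod h) (l l' : F) :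
    (settingOne p).incidence A A' l l' =
      (({a : Fˣ | l - a * p A = l' - a * p A'} : Finset Fˣ).card : ℝ) := by
  rw [Setting.incidence, Setting.blockMatrix, Setting.blockMatrix, designMatrix_transpose_mul_apply,
    Nat.cast_inj]
  have hlevel (u : Fˣ × F) : (settingOne p).level u A = l ∧ (settingOne p).level u A' = l' ↔
      l - u.1 * p A = l' - u.1 * p A' ∧ l - u.1 * p A = u.2 := by
    simp only [settingOne, ← eq_sub_iff_add_eq']
    exact ⟨fun hu => ⟨hu.1.symm.trans hu.2, hu.1.symm⟩, fun hu => ⟨hu.2.symm, hu.2.symm.trans hu.1⟩⟩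
  simp only [hlevel]
  exact Finset.card_bij' (fun u _ => u.1) (fun a _ => (a, l - a * p A)) (by simp +contextual)
    (by simp +contextual) (by simp +contextual [Prod.ext_iff]) (by simp)

theorem settingOne_isUniform (hp : Function.Injective p) : (settingOne p).IsUniform := by
  refine ⟨fun A => ?_, fun A A' hA => ?_⟩ <;> ext l l' <;> rw [settingOne_incidence_apply]
  · rcases eq_or_ne l l' with rfl | hl
    · simp [Fintype.card_units, Nat.cast_sub Fintype.card_pos]
    · simp [hl]
  · have hne : (p A : F) - p A' ≠ 0 := sub_ne_zero.2 fun hpA => hA (hp (Units.ext hpA))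
    have hiff (a : Fˣ) : l - a * p A = l' - a * p A' ↔ (l - l') / (p A - p A') = a := by
      rw [div_eq_iff hne]
      exact ⟨fun ha => by linear_combination ha, fun ha => by linear_combination ha⟩
    simp only [hiff]
    rcases eq_or_ne l l' with rfl | hl
    · simp [eq_comm]
    · lift (l - l') / (p A - p A') to Fˣ using (div_ne_zero (sub_ne_zero.2 hl) hne).isUnit with a
      simp [Units.val_inj, hl, Finset.filter_eq]

theorem settingOne_isTypeOne (hp : Function.Injective p) : (settingOne p).IsTypeOne :=
  ⟨by rw [Fintype.card_prod, Fintype.card_units, mul_comm], (settingOne_isUniform hp).2⟩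

theorem dOne_hasReplication : (dOne C p).HasReplication (Nat.card C₀) := by
  rintro ⟨x, i⟩
  have htreatment (u : Fˣ × F) :
      (dOne C p).treatment u = (x, i) ↔ cosetIndex C u.1 = i ∧ x = u.2 :=
    Prod.ext_iff.trans (and_comm.trans (and_congr_right' eq_comm))
  rw [← card_cosetIndex_eq C i]
  simp only [htreatment]
  exact Finset.card_bij' (fun u _ => u.1) (fun a _ => (a, x)) (by simp +contextual)
    (by simp +contextual) (by simp +contextual) (by simp)

theorem dOne_incidence_apply (hp : ∀ i, cosetIndex C (p i) = i) (A j : ZMod h) (x l : F) :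
    (dOne C p).incidence A (x, j) l = cosetIndicator C (j + A) (l - x) := by
  rw [Design.incidence_apply, cosetIndicator_eq_card, Nat.cast_inj]
  have htreatment_level (u : Fˣ × F) :
      (dOne C p).treatment u = (x, j) ∧ (settingOne p).level u A = l ↔
        (cosetIndex C (u.1 * p A) = j + A ∧ ((u.1 * p A : Fˣ) : F) = l - x) ∧ x = u.2 := by
    rw [cosetIndex_mul, hp, add_left_inj, Units.val_mul, eq_sub_iff_add_eq]
    constructor
    · rintro ⟨⟨rfl, rfl⟩, rfl⟩
      exact ⟨⟨rfl, rfl⟩, rfl⟩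
    · rintro ⟨⟨rfl, rfl⟩, rfl⟩
      exact ⟨rfl, rfl⟩
  simp only [htreatment_level]
  exact Finset.card_bij' (fun u _ => u.1 * p A) (fun a _ => (a / p A, x)) (by simp +contextual)
    (by simp +contextual) (by simp +contextual) (by simp)

variable [NeZero h]

theorem dOne_totalIncidence_apply (hp : ∀ i, cosetIndex C (p i) = i) (x l : F) (j : ZMod h) :
    (dOne C p).totalIncidence (x, j) l = 1 - if x = l then 1 else 0 := by
  simp only [Design.totalIncidence, Matrix.sum_apply, dOne_incidence_apply hp,
    sum_cosetIndicator_add_left, sub_eq_zero, eq_comm (a := l)]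
  split_ifs <;> simp

theorem dOne_totallyBinary (hp : ∀ i, cosetIndex C (p i) = i) : (dOne C p).TotallyBinary := by
  rintro ⟨x, j⟩ l
  rw [dOne_totalIncidence_apply hp]
  split_ifs <;> simp

theorem dOne_totalIncidence_mul_averaging_mul_transpose (hp : ∀ i, cosetIndex C (p i) = i) :
    (dOne C p).totalIncidence * averaging F * (dOne C p).totalIncidenceᵀ =
      ((Fintype.card F - 1) ^ 2 / Fintype.card F : ℝ) • of fun _ _ => 1 :=
  mul_averaging_mul_transpose (by simp [dOne_totalIncidence_apply hp])
    (by simp [dOne_totalIncidence_apply hp])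

theorem dOne_totalIncidence_mul_centering_mul_transpose (hp : ∀ i, cosetIndex C (p i) = i)
    (x y : F) (j k : ZMod h) :
    ((dOne C p).totalIncidence * centering F * (dOne C p).totalIncidenceᵀ) (x, j) (y, k) =
      centering F x y := by
  have hH : ((dOne C p).totalIncidence * (dOne C p).totalIncidenceᵀ) (x, j) (y, k) =
      Fintype.card F - 2 + if x = y then 1 else 0 := by
    simp only [Matrix.mul_apply, transpose_apply, dOne_totalIncidence_apply hp, mul_sub, sub_mul,
      Finset.sum_sub_distrib, one_mul, mul_one, ite_mul, zero_mul, Finset.sum_const,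
      Finset.sum_ite_eq, Finset.mem_univ, if_true, Finset.card_univ, nsmul_eq_mul,
      eq_comm (a := y) (b := x)]
    ring
  rw [centering, Matrix.mul_sub, Matrix.mul_one, Matrix.sub_mul, Matrix.sub_apply, hH,
    dOne_totalIncidence_mul_averaging_mul_transpose hp]
  simp only [Matrix.sub_apply, averaging_apply, Matrix.one_apply, Matrix.smul_apply, of_apply,
    smul_eq_mul, mul_one]
  field_simp
  ring

theorem dOne_sum_incidence_mul_transpose (hp : ∀ i, cosetIndex C (p i) = i) (x y : F)
    (j k : ZMod h) :
    (∑ A, (dOne C p).incidence A * ((dOne C p).incidence A)ᵀ) (x, j) (y, k) =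
      if x = y then (if j = k then (Fintype.card F - 1 : ℝ) else 0)
      else Nat.card C₀ - if j = k then 1 else 0 := by
  simp only [Matrix.sum_apply, Matrix.mul_apply, transpose_apply, dOne_incidence_apply hp]
  rw [Finset.sum_comm]
  simp only [sum_cosetIndicator_mul]
  split_ifs with hxy <;>
    simp_all [sum_cosetIndicator_div_self, sum_cosetIndicator_div_of_ne, sub_eq_zero]

theorem dOne_sum_incidence_mul_centering_mul_transpose_sub (hp : ∀ i, cosetIndex C (p i) = i) :
    ∑ A, (dOne C p).incidence A * centering F * ((dOne C p).incidence A)ᵀ -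
        (h : ℝ)⁻¹ • ((dOne C p).totalIncidence * centering F * (dOne C p).totalIncidenceᵀ) =
      (Fintype.card F : ℝ) • centering F ⊗ₖ centering (ZMod h) := by
  have hF : (Fintype.card F : ℝ) = h * Nat.card C₀ + 1 :=
    mod_cast card_eq_mul_card_subgroup_add_one C
  have hh : (h : ℝ) ≠ 0 := NeZero.ne _
  have hF0 : (h * Nat.card C₀ + 1 : ℝ) ≠ 0 := by positivity
  have hr : (dOne C p).HasReplication (Nat.card C₀) := dOne_hasReplication
  have hN (A) := mul_averaging_mul_transpose (hr.sum_incidence A) (hr.sum_incidence A)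
  ext ⟨x, j⟩ ⟨y, k⟩
  rw [Matrix.sub_apply, Matrix.smul_apply, dOne_totalIncidence_mul_centering_mul_transpose hp]
  simp only [centering, Matrix.mul_sub, Matrix.mul_one, Matrix.sub_mul, Finset.sum_sub_distrib,
    Matrix.sub_apply, dOne_sum_incidence_mul_transpose hp, hN, Matrix.smul_apply,
    kroneckerMap_apply, averaging_apply, Matrix.one_apply]
  simp only [Matrix.sum_apply, Matrix.smul_apply, of_apply, smul_eq_mul, Finset.sum_const,
    Finset.card_univ, ZMod.card, nsmul_eq_mul, hF]
  split_ifs <;> field_simp <;> ring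

theorem dOne_component_stratumProj (hp : ∀ i, cosetIndex C (p i) = i) (i : Fin 3) :
    (dOne C p).component ((settingOne p).stratumProj i) =
      (![Nat.card C₀, (Fintype.card F - h : ℝ)⁻¹, 1] : Fin 3 → ℝ) i • stratum F (ZMod h) i := by
  have hF : (Fintype.card F : ℝ) = h * Nat.card C₀ + 1 :=
    mod_cast card_eq_mul_card_subgroup_add_one C
  have ht : (Nat.card C₀ : ℝ) ≠ 0 := mod_cast Nat.card_pos.ne'
  have hh : (h : ℝ) ≠ 0 := NeZero.ne _
  have hF0 : (h * Nat.card C₀ + 1 : ℝ) ≠ 0 := by positivity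
  rw [Design.component_stratumProj, ZMod.card]
  fin_cases i <;> simp only [Fin.reduceFinMk, Setting.stratumEigenvalue, stratum, Matrix.cons_val]
  · ext ⟨x, j⟩ ⟨y, k⟩
    simp only [dOne_totalIncidence_mul_averaging_mul_transpose hp, kroneckerMap_apply,
      averaging_apply, Matrix.smul_apply, of_apply, smul_eq_mul, ZMod.card, hF]
    field_simp
    ring
  · ext ⟨x, j⟩ ⟨y, k⟩
    simp only [dOne_totalIncidence_mul_centering_mul_transpose hp, kroneckerMap_apply,
      averaging_apply, Matrix.smul_apply, smul_eq_mul, ZMod.card]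
    ring
  · rw [dOne_sum_incidence_mul_centering_mul_transpose_sub hp, inv_smul_smul₀ (hF ▸ hF0), one_smul]

theorem dOne_connected (hp : ∀ i, cosetIndex C (p i) = i) (ht : 2 ≤ Nat.card C₀) :
    (dOne C p).Connected := by
  have hF : (h : ℝ) + 1 ≤ Fintype.card F := by
    exact_mod_cast ZMod.card h ▸ Nat.succ_le_of_lt (card_zmod_lt_card C)
  have ht' : (2 : ℝ) ≤ Nat.card C₀ := mod_cast ht
  have hloss : (Fintype.card F - h : ℝ)⁻¹ ≤ 1 := inv_le_one_of_one_le₀ (by linarith)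
  have hC := (dOne_hasReplication (C := C) (p := p)).cMatrix_eq
    ((settingOne_isUniform (Function.LeftInverse.injective hp)).colProj_nuisanceMatrix
      (card_zmod_lt_card C))
  simp only [dOne_component_stratumProj hp, Fin.sum_univ_three] at hC
  have hE (i) : 0 ≤ stratum F (ZMod h) i := (isStarProjection_stratum i).nonneg
  have hsplit : (dOne C p).cMatrix + (Nat.card C₀ : ℝ) • averaging (F × ZMod h) =
      (Nat.card C₀ - 1 : ℝ) • 1 + ((1 - ∑ i, stratum F (ZMod h) i) + stratum F (ZMod h) 0 +
        (1 - (Fintype.card F - h : ℝ)⁻¹) • stratum F (ZMod h) 1) := by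
    rw [hC, ← averaging_kronecker_averaging, Fin.sum_univ_three]
    simp only [stratum, Matrix.cons_val]
    module
  refine (dOne C p).connected_of_isUnit (c := Nat.card C₀) ?_ (by positivity)
  rw [hsplit]
  refine ((PosDef.one.smul (by linarith : (0 : ℝ) < Nat.card C₀ - 1)).add_posSemidef
    (nonneg_iff_posSemidef.1 ?_)).isUnit
  exact add_nonneg (add_nonneg (sub_nonneg.2 sum_stratum_le_one) (hE 0))
    (smul_nonneg (sub_nonneg.2 hloss) (hE 1))

theorem dOne_mOptimal (hp : ∀ i, cosetIndex C (p i) = i) :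
    Design.MOptimal (Design.equireplicateTotallyBinary (settingOne p)) (dOne C p) := by
  have hd : (dOne C p).HasReplication (Nat.card C₀) := dOne_hasReplication
  have hσ : (settingOne p).IsUniform := settingOne_isUniform (Function.LeftInverse.injective hp)
  have hBL := card_zmod_lt_card C
  refine ⟨⟨⟨_, hd⟩, dOne_totallyBinary hp⟩, fun d' ⟨hd'eq, hd'bin⟩ => ?_⟩
  have hd' : d'.HasReplication (Nat.card C₀) := hd'eq.hasReplication hd.card_eq
  exact hd.mBetter_of_component_eq_smul hd' (hσ.colProj_nuisanceMatrix hBL)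
    (hσ.isStarProjection_stratumProj hBL) (fun i => (isStarProjection_stratum i).nonneg)
    sum_stratum_le_one (fun i => (hσ.trace_stratumProj hBL i).symm)
    (dOne_component_stratumProj hp)
    (hd.trace_component_stratumProj_eq hd' (dOne_totallyBinary hp) hd'bin)

end DOne

end MultiwayDesign

theorem theorem5p1 {F : Type*} [Field F] [Fintype F] [DecidableEq F]
    (h t : ℕ) [NeZero h] (ht : 2 ≤ t) (hF : Fintype.card F = h * t + 1)
    (C₀ : Subgroup Fˣ) (hC₀ : Nat.card C₀ = t)
    (C : Multiplicative (ZMod h) ≃* Fˣ ⧸ C₀)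
    (p : ZMod h → Fˣ)
    (hp : ∀ i : ZMod h, (p i : Fˣ ⧸ C₀) = C (Multiplicative.ofAdd i)) :
    (MultiwayDesign.settingOne p).IsTypeOne ∧
      (MultiwayDesign.dOne C p).Connected ∧
      MultiwayDesign.Design.MOptimal
        (MultiwayDesign.Design.equireplicateTotallyBinary (MultiwayDesign.settingOne p))
        (MultiwayDesign.dOne C p) := by
  have hindex (i : ZMod h) : MultiwayDesign.cosetIndex C (p i) = i :=
    (MultiwayDesign.cosetIndex_eq_iff C (p i) i).2 (hp i)
  exact ⟨MultiwayDesign.settingOne_isTypeOne (Function.LeftInverse.injective hindex),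
    MultiwayDesign.dOne_connected hindex (hC₀ ▸ ht), MultiwayDesign.dOne_mOptimal hindex⟩
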